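/- Let $G$ be a finite group and let $X$ be a paracompact Hausdorff $G$-space, i.e. a paracompact Hausdorff topological space with an action of $G$ by homeomorphisms. Let $\mathcal U=\{U_\lambda\}_{\lambda\in\Lambda}$ be a $G$-invariant open cover of $X$: the index set $\Lambda$ carries an action of $G$ such that $U_{g\lambda}=gU_\lambda$ for all $g\in G$ and $\lambda\in\Lambda$. Let $\mathrm N\,\mathcal U$ be the nerve of $\mathcal U$, i.e. the simplicial complex whose simplices are the nonempty finite subsets $\sigma\subseteq\Lambda$ for which $U_\sigma:=\bigcap_{\lambda\in\sigma}U_\lambda$ is nonempty. For each simplex $\sigma$ let $G_\sigma:=\{g\in G: g\sigma=\sigma\}$ be its (setwise) isotropy subgroup, which acts on $U_\sigma$ by restriction. A $G$-map between $G$-spaces is a continuous $G$-equivariant map. Two $G$-maps $\varphi,\varphi':Y\to Z$ are $G$-homotopic if there is a continuous map $H:Y\times[0,1]\to Z$ with $H(\cdot,0)=\varphi$ and $H(\cdot,1)=\varphi'$ such that $H(\cdot,t)$ is a $G$-map for every $t\in[0,1]$. Two $G$-spaces $Y,Z$ are $G$-homotopy equivalent if there are $G$-maps $\varphi:Y\to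 Z$ and $\psi:Z\to Y$ such that $\psi\circ\varphi$ is $G$-homotopic to $\mathrm{id}_Y$ and $\varphi\circ\psi$ is $G$-homotopic to $\mathrm{id}_Z$. A $G$-space is $G$-contractible if it is $G$-homotopy equivalent to a one-point space. Assume that $U_\sigma$ is $G_\sigma$-contractible for every simplex $\sigma\in\mathrm N\,\mathcal U$. Then $X$ is $G$-homotopy equivalent to the geometric realization $|\mathrm N\,\mathcal U|$, equipped with the weak topology and with the $G$-action induced by the action of $G$ on $\Lambda$. -/

import Mathlib

open scoped Pointwise

noncomputable section

namespace EquivariantNerve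

/-! ### `G`-maps, `G`-homotopies, `G`-homotopy equivalences

A `G`-space is a topological space `X` with an action of the (discrete) group `G` by homeomorphisms:
`[MulAction G X] [ContinuousConstSMul G X]`. -/

section GHomotopy

variable (G : Type*) [Group G]

/-- A continuous map between `G`-spaces is a `G`-map if it commutes with the actions. -/
def IsGMap {X Y : Type*} [TopologicalSpace X] [TopologicalSpace Y] [MulAction G X] [MulAction G Y]
    (φ : C(X, Y)) : Prop :=
  ∀ (g : G) (x : X), φ (g • x) = g • φ x

/-- Two maps `φ, φ' : X → Y` are `G`-homotopic if there is a homotopy `H : X × [0,1] → Y` from `φ` to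
`φ'` every stage `H(·, t)` of which is a `G`-map. (In particular `φ` and `φ'` are then `G`-maps.) -/
def GHomotopic {X Y : Type*} [TopologicalSpace X] [TopologicalSpace Y]
    [MulAction G X] [MulAction G Y] (φ φ' : C(X, Y)) : Prop :=
  ∃ H : C(X × unitInterval, Y), (∀ x, H (x, 0) = φ x) ∧ (∀ x, H (x, 1) = φ' x) ∧
    ∀ (t : unitInterval) (g : G) (x : X), H (g • x, t) = g • H (x, t)

/-- `X` and `Y` are `G`-homotopy equivalent. -/
def GHomotopyEquivalent (X Y : Type*) [TopologicalSpace X] [TopologicalSpace Y]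
    [MulAction G X] [ContinuousConstSMul G X] [MulAction G Y] [ContinuousConstSMul G Y] : Prop :=
  ∃ (φ : C(X, Y)) (ψ : C(Y, X)), IsGMap G φ ∧ IsGMap G ψ ∧
    GHomotopic G (ψ.comp φ) (ContinuousMap.id X) ∧ GHomotopic G (φ.comp ψ) (ContinuousMap.id Y)

/-- `X` is `G`-contractible if it is `G`-homotopy equivalent to a point with the trivial action. -/
def GContractible (X : Type*) [TopologicalSpace X]
    [MulAction G X] [ContinuousConstSMul G X] : Prop :=
  GHomotopyEquivalent G X PUnit.{1}

end GHomotopy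

/-! ### Geometric realization of an abstract simplicial complex -/

/-- A point of the geometric realization of `K`, in barycentric coordinates: finitely supported
nonnegative weights on the vertices, with sum `1`, the vertices of nonzero weight forming a simplex
of `K`. -/
@[ext]
structure Realization {ι : Type*} (K : PreAbstractSimplicialComplex ι) where
  weight : ι →₀ ℝ
  nonneg : ∀ i, 0 ≤ weight i
  sum_eq_one : (weight.sum fun _ a => a) = 1
  support_mem : weight.support ∈ K.faces

namespace Realization

variable {ι : Type*} {K : PreAbstractSimplicialComplex ι}

/-- The weights on `ι` obtained from barycentric coordinates on `σ` by extending them by `0`. -/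
def extendWeight (σ : Finset ι) (p : σ → ℝ) : ι →₀ ℝ :=
  (Finsupp.equivFunOnFinite.symm p).embDomain (Function.Embedding.subtype (· ∈ σ))

theorem extendWeight_of_mem {σ : Finset ι} (p : σ → ℝ) {i : ι} (hi : i ∈ σ) :
    extendWeight σ p i = p ⟨i, hi⟩ :=
  Finsupp.embDomain_apply_self (Function.Embedding.subtype (· ∈ σ))
    (Finsupp.equivFunOnFinite.symm p) ⟨i, hi⟩

theorem extendWeight_of_notMem {σ : Finset ι} (p : σ → ℝ) {i : ι} (hi : i ∉ σ) :
    extendWeight σ p i = 0 :=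
  Finsupp.embDomain_of_notMem_range _ _ _ (by simpa using hi)

theorem support_extendWeight_subset (σ : Finset ι) (p : σ → ℝ) :
    (extendWeight σ p).support ⊆ σ := by
  intro i hi
  by_contra h
  exact (Finsupp.mem_support_iff.1 hi) (extendWeight_of_notMem p h)

theorem sum_extendWeight (σ : Finset ι) (p : σ → ℝ) :
    ((extendWeight σ p).sum fun _ a => a) = ∑ i, p i := by
  rw [Finsupp.sum_of_support_subset _ (support_extendWeight_subset σ p) _ (fun _ _ => rfl),
    ← Finset.sum_coe_sort]
  exact Finset.sum_congr rfl fun i _ => extendWeight_of_mem p i.2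

/-- The closed simplex of the realization spanned by the simplex `σ` of `K`, as a map from the
standard simplex with vertex set `σ`. -/
def simplexMap (σ : K.faces) (p : stdSimplex ℝ (σ : Finset ι)) : Realization K where
  weight := extendWeight σ p.1
  nonneg i := by
    by_cases hi : i ∈ (σ : Finset ι)
    · rw [extendWeight_of_mem _ hi]
      exact p.2.1 _
    · rw [extendWeight_of_notMem _ hi]
  sum_eq_one := by
    rw [sum_extendWeight]
    exact p.2.2
  support_mem := by
    refine (K.isRelLowerSet_faces σ.2).2 (support_extendWeight_subset _ _) ?_
    rw [Finset.nonempty_iff_ne_empty]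
    intro h
    have h1 := sum_extendWeight (σ : Finset ι) p.1
    rw [p.2.2, Finsupp.sum, h, Finset.sum_empty] at h1
    exact zero_ne_one h1

/-- The weak (coherent) topology: the finest one for which all the closed simplices
`simplexMap σ` are continuous. Thus a set is open iff its trace on every closed simplex is. -/
instance : TopologicalSpace (Realization K) :=
  ⨆ σ : K.faces, TopologicalSpace.coinduced (simplexMap σ) inferInstance

theorem continuous_simplexMap (σ : K.faces) : Continuous (simplexMap σ) :=
  continuous_iff_coinduced_le.2
    (le_iSup (fun σ : K.faces => TopologicalSpace.coinduced (simplexMap σ) inferInstance) σ)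

end Realization

/-! ### Invariant covers and their nerves -/

/-- A `G`-invariant open cover `(U i)_{i : ι}` of the `G`-space `X`, with respect to the given action
of `G` on the index set: `U (g • i) = g • U i`. -/
structure InvariantOpenCover (G X ι : Type*) [Group G] [TopologicalSpace X]
    [MulAction G X] [MulAction G ι] where
  U : ι → Set X
  isOpen : ∀ i, IsOpen (U i)
  iUnion_eq : ⋃ i, U i = Set.univ
  smul_eq : ∀ (g : G) (i : ι), U (g • i) = g • U i

namespace InvariantOpenCover

variable {G X ι : Type*} [Group G] [TopologicalSpace X] [MulAction G X] [MulAction G ι]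
  (𝒰 : InvariantOpenCover G X ι)

/-- `U_σ`, the intersection of the members of the cover with index in `σ`. -/
def inter (σ : Finset ι) : Set X := ⋂ i ∈ σ, 𝒰.U i

/-- The nerve: its simplices are the nonempty finite sets `σ` of indices with `U_σ ≠ ∅`. -/
def nerve : PreAbstractSimplicialComplex ι where
  faces := {σ | σ.Nonempty ∧ (𝒰.inter σ).Nonempty}
  isRelLowerSet_faces := by
    rintro σ ⟨hσ, hU⟩
    exact ⟨hσ, fun τ hτ hne => ⟨hne, hU.mono (Set.biInter_subset_biInter_left hτ)⟩⟩

theorem smul_mem_U {g : G} {i : ι} {x : X} (hx : x ∈ 𝒰.U i) : g • x ∈ 𝒰.U (g • i) := by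
  rw [𝒰.smul_eq]
  exact Set.smul_mem_smul_set hx

/-- The image of the finite set `σ` under the permutation `i ↦ g • i` of the indices. -/
def smulSimplex (g : G) (σ : Finset ι) : Finset ι := σ.map (MulAction.toPerm g).toEmbedding

theorem mem_smulSimplex {g : G} {σ : Finset ι} {i : ι} :
    i ∈ smulSimplex g σ ↔ g⁻¹ • i ∈ σ := by
  simp only [smulSimplex, Finset.mem_map_equiv]
  rfl

theorem smulSimplex_mem_nerve (g : G) {σ : Finset ι} (hσ : σ ∈ 𝒰.nerve.faces) :
    smulSimplex g σ ∈ 𝒰.nerve.faces := by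
  obtain ⟨hne, x, hx⟩ := hσ
  refine ⟨hne.map, g • x, Set.mem_iInter₂.2 fun i hi => ?_⟩
  have h := 𝒰.smul_mem_U (g := g) (Set.mem_iInter₂.1 hx _ (mem_smulSimplex.1 hi))
  rwa [smul_inv_smul] at h

/-- `G` acts on the realization of the nerve by permuting the barycentric coordinates. -/
instance : MulAction G (Realization 𝒰.nerve) where
  smul g w :=
    { weight := w.weight.equivMapDomain (MulAction.toPerm g)
      nonneg := fun i => by
        rw [Finsupp.equivMapDomain_apply]
        exact w.nonneg _
      sum_eq_one := by
        rw [Finsupp.sum_equivMapDomain]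
        exact w.sum_eq_one
      support_mem := 𝒰.smulSimplex_mem_nerve g w.support_mem }
  one_smul w := by
    apply Realization.ext
    ext i
    change w.weight ((1 : G)⁻¹ • i) = _
    rw [inv_one, one_smul]
  mul_smul g h w := by
    apply Realization.ext
    ext i
    change w.weight ((g * h)⁻¹ • i) = w.weight (h⁻¹ • g⁻¹ • i)
    rw [mul_inv_rev, mul_smul]

theorem weight_smul (g : G) (w : Realization 𝒰.nerve) (i : ι) :
    (g • w).weight i = w.weight (g⁻¹ • i) := rfl

/-- The realization of the nerve is a `G`-space. -/
instance : ContinuousConstSMul G (Realization 𝒰.nerve) where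
  continuous_const_smul g := by
    refine continuous_iSup_dom.2 fun σ => continuous_coinduced_dom.2 ?_
    let τ : 𝒰.nerve.faces := ⟨smulSimplex g σ, 𝒰.smulSimplex_mem_nerve g σ.2⟩
    let e : (τ : Finset ι) ≃ (σ : Finset ι) :=
      { toFun := fun i => ⟨g⁻¹ • (i : ι), mem_smulSimplex.1 i.2⟩
        invFun := fun i => ⟨g • (i : ι), mem_smulSimplex.2 (by rw [inv_smul_smul]; exact i.2)⟩
        left_inv := fun i => Subtype.ext (smul_inv_smul g (i : ι))
        right_inv := fun i => Subtype.ext (inv_smul_smul g (i : ι)) }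
    let f : stdSimplex ℝ (σ : Finset ι) → stdSimplex ℝ (τ : Finset ι) := fun p =>
      ⟨fun i => p.1 (e i), fun i => p.2.1 _,
        (Equiv.sum_comp e _).trans p.2.2⟩
    have hf : Continuous f :=
      Continuous.subtype_mk
        (continuous_pi fun i =>
          (continuous_apply (A := fun _ : (σ : Finset ι) => ℝ) (e i)).comp
            continuous_subtype_val) _
    have key : (fun w : Realization 𝒰.nerve => g • w) ∘ Realization.simplexMap σ =
        Realization.simplexMap τ ∘ f := by
      funext p
      apply Realization.ext
      ext i
      change Realization.extendWeight (σ : Finset ι) p.1 (g⁻¹ • i) =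
        Realization.extendWeight (τ : Finset ι) (f p).1 i
      by_cases hi : i ∈ (τ : Finset ι)
      · rw [Realization.extendWeight_of_mem _ hi,
          Realization.extendWeight_of_mem _ (mem_smulSimplex.1 hi)]
        rfl
      · rw [Realization.extendWeight_of_notMem _ hi,
          Realization.extendWeight_of_notMem _ (fun h => hi (mem_smulSimplex.2 h))]
    rw [key]
    exact (Realization.continuous_simplexMap τ).comp hf

/-- `G_σ = {g ∈ G | g σ = σ}`, the setwise stabilizer of `σ`. -/
abbrev isotropy (G : Type*) {ι : Type*} [Group G] [MulAction G ι] (σ : Finset ι) : Subgroup G :=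
  MulAction.stabilizer G (σ : Set ι)

theorem smul_mem_inter {σ : Finset ι} (g : isotropy G σ) {x : X} (hx : x ∈ 𝒰.inter σ) :
    (g : G) • x ∈ 𝒰.inter σ := by
  refine Set.mem_iInter₂.2 fun i hi => ?_
  have hi' : i ∈ (g : G) • (σ : Set ι) := by
    rw [MulAction.mem_stabilizer_iff.1 g.2]
    exact hi
  obtain ⟨j, hj, rfl⟩ := hi'
  exact 𝒰.smul_mem_U (Set.mem_iInter₂.1 hx j hj)

/-- `G_σ` acts on `U_σ` by restriction of the action of `G` on `X`. -/
instance (σ : Finset ι) : MulAction (isotropy G σ) (𝒰.inter σ) where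
  smul g x := ⟨(g : G) • (x : X), 𝒰.smul_mem_inter g x.2⟩
  one_smul x := Subtype.ext (one_smul G (x : X))
  mul_smul g h x := Subtype.ext (mul_smul (g : G) (h : G) (x : X))

instance (σ : Finset ι) [ContinuousConstSMul G X] :
    ContinuousConstSMul (isotropy G σ) (𝒰.inter σ) where
  continuous_const_smul g :=
    Continuous.subtype_mk (continuous_subtype_val.const_smul (g : G)) _

end InvariantOpenCover

end EquivariantNerve

end

/-!
A `G`-invariant partition of unity subordinate to the cover is a `G`-map `φ : X → |N|`
(`exists_equivariant_partitionOfUnity`). Its homotopy inverse is built without any induction over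
skeleta, by composing contractions.

Contractions `k_σ` of all the sets `U_σ` are chosen compatibly with the action
(`exists_contractionSystem`). For a point `w` of `|N|`, the superlevel sets of its (truncated)
barycentric coordinates form a chain `σ₀ ⊂ ⋯ ⊂ σₘ` inside the support of `w`. Every finite set `σ`
gets a real number `level σ w`, depending continuously on `w` on each closed simplex, which is
positive precisely on this chain, and which is at least `1` somewhere on it
(`exists_one_le_level`). If `x` lies in `U_σ` for the support `σ` of `w`, the composite `k_σ₀ ∘ ⋯ ∘
k_σₘ`, with `k_σ` at time `u * level σ w`, can be applied to `x`, since `U_σₘ ⊆ ⋯ ⊆ U_σ₀`; this is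
`fullFlow w u x`. A contraction at time `0` is the identity, so the flow remains continuous where
the chain changes (`continuousAt_stage`). Uniqueness of the chain makes the flow equivariant.

* At `u = 1` some contraction is carried out completely, so the result does not depend on `x`
  (`fullFlow_one_eq`). It defines `ψ : |N| → X` (`fromNerve`).
* `u ↦ fullFlow (φ x) u x` is a homotopy from the identity to `ψ ∘ φ`.
* The coordinates are truncated so that all members of the chain contain the set `top w` of the
  vertices at which the coordinate of `w` is large. So `ψ w` lies in `U_σ` for `σ = top w`
  (`fromNerve_mem_inter_top`), and `top w` together with the support of `φ (ψ w)` is a simplex.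
  Straight lines thus join `φ (ψ w)` to a point `concentrate w` supported in `top w`, and that
  point to `w`.

Continuity of a map into the weak topology is obtained from the continuity of its coordinates when
the map is locally supported in a single simplex (`continuous_of_eventually_support_subset`). The
map `φ` has this property, and so do the other maps to the realization after restriction to closed
simplices.
-/

open scoped NNReal Topology

noncomputable section

namespace EquivariantNerve

/-! ### The topology of the realization -/

namespace Realization

variable {ι : Type*} {K : PreAbstractSimplicialComplex ι}

theorem support_mem_of_subset {w : ι →₀ ℝ} (hw : (w.sum fun _ a => a) = 1) {F : Finset ι}
    (hF : F ∈ K.faces) (h : w.support ⊆ F) : w.support ∈ K.faces := by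
  refine (K.isRelLowerSet_faces hF).2 h ?_
  rw [Finset.nonempty_iff_ne_empty]
  intro h0
  rw [Finsupp.sum, h0, Finset.sum_empty] at hw
  exact zero_ne_one hw

theorem support_nonempty (w : Realization K) : w.weight.support.Nonempty :=
  (K.isRelLowerSet_faces w.support_mem).1

theorem sum_eq_one_of_subset (w : Realization K) {F : Finset ι} (h : w.weight.support ⊆ F) :
    ∑ i ∈ F, w.weight i = 1 := by
  rw [← w.sum_eq_one, Finsupp.sum_of_support_subset _ h _ fun _ _ => rfl]

theorem support_simplexMap_subset (σ : K.faces) (p : stdSimplex ℝ (σ : Finset ι)) :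
    (simplexMap σ p).weight.support ⊆ σ :=
  support_extendWeight_subset _ _

theorem exists_simplexMap_eq (σ : K.faces) {w : Realization K} (h : w.weight.support ⊆ σ) :
    ∃ p, simplexMap σ p = w := by
  refine ⟨⟨fun i => w.weight i, fun i => w.nonneg i, ?_⟩, ?_⟩
  · rw [Finset.sum_coe_sort (σ : Finset ι) fun i => w.weight i]
    exact w.sum_eq_one_of_subset h
  · apply Realization.ext
    ext i
    change extendWeight (σ : Finset ι) _ i = _
    by_cases hi : i ∈ (σ : Finset ι)
    · rw [extendWeight_of_mem _ hi]
    · rw [extendWeight_of_notMem _ hi]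
      exact (Finsupp.notMem_support_iff.1 fun h' => hi (h h')).symm

theorem continuous_of_simplexMap {Z : Type*} [TopologicalSpace Z] {f : Realization K → Z}
    (h : ∀ σ : K.faces, Continuous fun p => f (simplexMap σ p)) : Continuous f :=
  continuous_iSup_dom.2 fun σ => continuous_coinduced_dom.2 (h σ)

/-- The topology of `Realization K × unitInterval` is also coherent with the closed simplices:
since `unitInterval` is compact, a homotopy may be curried to a map into a path space. -/
theorem continuous_prod_of_simplexMap {Z : Type*} [TopologicalSpace Z]
    {f : Realization K × unitInterval → Z}
    (h : ∀ σ : K.faces, Continuous fun q : stdSimplex ℝ (σ : Finset ι) × unitInterval =>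
      f (simplexMap σ q.1, q.2)) : Continuous f := by
  have hf : ∀ w, Continuous fun t => f (w, t) := fun w => by
    obtain ⟨p, hp⟩ := exists_simplexMap_eq ⟨_, w.support_mem⟩ (w := w) subset_rfl
    rw [← hp]
    exact (h _).comp (Continuous.prodMk_right p)
  let F : Realization K → C(unitInterval, Z) := fun w => ⟨fun t => f (w, t), hf w⟩
  have hF : Continuous F := continuous_of_simplexMap fun σ =>
    ContinuousMap.continuous_of_continuous_uncurry _ (h σ)
  exact ContinuousMap.continuous_uncurry_of_continuous ⟨F, hF⟩

theorem continuous_weight (i : ι) : Continuous fun w : Realization K => w.weight i := by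
  refine continuous_of_simplexMap fun σ => ?_
  by_cases hi : i ∈ (σ : Finset ι)
  · have : (fun p => (simplexMap σ p).weight i) = fun p => p.1 ⟨i, hi⟩ :=
      funext fun p => extendWeight_of_mem _ hi
    rw [this]
    exact (continuous_apply (A := fun _ : (σ : Finset ι) => ℝ) _).comp continuous_subtype_val
  · have : (fun p => (simplexMap σ p).weight i) = fun _ => 0 :=
      funext fun p => extendWeight_of_notMem _ hi
    rw [this]
    exact continuous_const

/-- A map into the realization whose barycentric coordinates are continuous is continuous for the
weak topology as soon as it takes values, locally, in a single closed simplex. -/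
theorem continuous_of_eventually_support_subset {Y : Type*} [TopologicalSpace Y]
    {f : Y → Realization K} (hf : ∀ i, Continuous fun y => (f y).weight i)
    (hF : ∀ y₀, ∃ F ∈ K.faces, ∀ᶠ y in 𝓝 y₀, (f y).weight.support ⊆ F) : Continuous f := by
  refine continuous_iff_continuousAt.2 fun y₀ => ?_
  obtain ⟨F, hFK, hV⟩ := hF y₀
  set V : Set Y := {y | (f y).weight.support ⊆ F}
  have hsum : ∀ y : V, ∑ i : F, (f y).weight i = 1 := fun y => by
    rw [Finset.sum_coe_sort F fun i => (f y).weight i]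
    exact (f y).sum_eq_one_of_subset y.2
  let g : V → stdSimplex ℝ F := fun y =>
    ⟨fun i => (f y).weight i, fun i => (f y).nonneg i, hsum y⟩
  have hg : Continuous g :=
    continuous_induced_rng.2 (continuous_pi fun i => (hf i).comp continuous_subtype_val)
  have key : V.domRestrict f = simplexMap ⟨F, hFK⟩ ∘ g := by
    funext y
    apply Realization.ext
    ext i
    change (f y).weight i = extendWeight F _ i
    by_cases hi : i ∈ F
    · rw [extendWeight_of_mem _ hi]
    · rw [extendWeight_of_notMem _ hi]
      exact Finsupp.notMem_support_iff.1 fun h' => hi (y.2 h')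
  refine ContinuousOn.continuousAt ?_ hV
  rw [continuousOn_iff_continuous_domRestrict, key]
  exact (continuous_simplexMap _).comp hg

/-- The point `(1 - t) • a + t • b`, for points `a`, `b` of a common closed simplex `F`. -/
def mix {F : Finset ι} (hF : F ∈ K.faces) (a b : Realization K) (ha : a.weight.support ⊆ F)
    (hb : b.weight.support ⊆ F) (t : unitInterval) : Realization K :=
  have hsub : ((1 - (t : ℝ)) • a.weight + (t : ℝ) • b.weight).support ⊆ F := by
    classical
    exact Finsupp.support_add.trans (Finset.union_subset
      (Finsupp.support_smul.trans ha) (Finsupp.support_smul.trans hb))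
  have hsum : (((1 - (t : ℝ)) • a.weight + (t : ℝ) • b.weight).sum fun _ x => x) = 1 := by
    rw [Finsupp.sum_of_support_subset _ hsub _ fun _ _ => rfl]
    simp only [Finsupp.add_apply, Finsupp.smul_apply, smul_eq_mul, Finset.sum_add_distrib,
      ← Finset.mul_sum, a.sum_eq_one_of_subset ha, b.sum_eq_one_of_subset hb]
    ring
  { weight := (1 - (t : ℝ)) • a.weight + (t : ℝ) • b.weight
    nonneg := fun i => add_nonneg (mul_nonneg (sub_nonneg.2 t.2.2) (a.nonneg i))
      (mul_nonneg t.2.1 (b.nonneg i))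
    sum_eq_one := hsum
    support_mem := support_mem_of_subset hsum hF hsub }

/-! ### The filtration of a point by its superlevel sets -/

/-- Half the sum of the squares of the barycentric coordinates. This is a continuous substitute for
a fixed fraction of the largest coordinate, which is at least twice as large. -/
def threshold (w : Realization K) : ℝ := (w.weight.sum fun _ a => a ^ 2) / 2

theorem threshold_pos (w : Realization K) : 0 < w.threshold := by
  refine half_pos (Finset.sum_pos (fun i hi => ?_) w.support_nonempty)
  exact pow_pos (lt_of_le_of_ne (w.nonneg i) (Finsupp.mem_support_iff.1 hi).symm) 2

theorem threshold_eq_of_subset (w : Realization K) {F : Finset ι} (h : w.weight.support ⊆ F) :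
    w.threshold = (∑ i ∈ F, w.weight i ^ 2) / 2 := by
  rw [threshold, Finsupp.sum_of_support_subset _ h _ fun _ _ => by simp]

theorem exists_threshold_lt (w : Realization K) : ∃ i, w.threshold < w.weight i := by
  by_contra! h
  have h1 : ∑ i ∈ w.weight.support, w.weight i ^ 2 ≤
      ∑ i ∈ w.weight.support, w.weight i * w.threshold :=
    Finset.sum_le_sum fun i _ => by
      rw [sq]
      exact mul_le_mul_of_nonneg_left (h i) (w.nonneg i)
  rw [← Finset.sum_mul, w.sum_eq_one_of_subset subset_rfl] at h1
  have h2 := w.threshold_eq_of_subset subset_rfl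
  have h3 := w.threshold_pos
  linarith

/-- The coordinates of `w`, truncated at the threshold and rescaled to have maximum `1`. -/
def height (w : Realization K) (i : ι) : ℝ≥0 := min (w.weight i / w.threshold).toNNReal 1

theorem height_le_one (w : Realization K) (i : ι) : w.height i ≤ 1 := min_le_right _ _

theorem height_pos_iff {w : Realization K} {i : ι} : 0 < w.height i ↔ i ∈ w.weight.support := by
  rw [height, lt_min_iff, Real.toNNReal_pos, Finsupp.mem_support_iff,
    div_pos_iff_of_pos_right w.threshold_pos]
  exact ⟨fun h => h.1.ne', fun h => ⟨lt_of_le_of_ne (w.nonneg i) h.symm, one_pos⟩⟩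

theorem height_eq_one_iff {w : Realization K} {i : ι} :
    w.height i = 1 ↔ w.threshold ≤ w.weight i := by
  rw [height, min_eq_right_iff, Real.one_le_toNNReal, one_le_div w.threshold_pos]

/-- The finite set of vertices at which the height is maximal. -/
def top (w : Realization K) : Finset ι := w.weight.support.filter fun i => w.threshold ≤ w.weight i

theorem mem_top {w : Realization K} {i : ι} : i ∈ w.top ↔ w.height i = 1 := by
  rw [top, Finset.mem_filter, height_eq_one_iff, and_iff_right_iff_imp]
  exact fun h => Finsupp.mem_support_iff.2 (w.threshold_pos.trans_le h).ne'

theorem top_nonempty (w : Realization K) : w.top.Nonempty :=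
  let ⟨i, hi⟩ := w.exists_threshold_lt
  ⟨i, mem_top.2 (height_eq_one_iff.2 hi.le)⟩

theorem top_subset (w : Realization K) : w.top ⊆ w.weight.support := Finset.filter_subset _ _

open scoped Classical in
/-- The amount by which the heights on `σ` exceed the heights off `σ`. It is positive exactly when
`σ` is nonempty and of the form `{i | a < height i}` with `0 ≤ a`. -/
def gap (σ : Finset ι) (w : Realization K) : ℝ :=
  1 - (σ.sup fun i => 1 - w.height i : ℝ≥0) -
    ((w.weight.support.filter fun j => j ∉ σ).sup w.height : ℝ≥0)

open scoped Classical in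
theorem height_add_gap_le {σ : Finset ι} {w : Realization K} {i j : ι} (hi : i ∈ σ) (hj : j ∉ σ) :
    w.height j + gap σ w ≤ w.height i := by
  have h1 : (1 - w.height i : ℝ≥0) ≤ σ.sup fun i => 1 - w.height i :=
    Finset.le_sup (f := fun i => 1 - w.height i) hi
  have h2 : w.height j ≤ (w.weight.support.filter fun j => j ∉ σ).sup w.height := by
    by_cases hjw : j ∈ w.weight.support
    · exact Finset.le_sup (Finset.mem_filter.2 ⟨hjw, hj⟩)
    · rw [← height_pos_iff, not_lt, nonpos_iff_eq_zero] at hjw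
      rw [hjw]
      exact zero_le
  rw [← NNReal.coe_le_coe] at h1 h2
  rw [NNReal.coe_sub (w.height_le_one i), NNReal.coe_one] at h1
  rw [gap]
  linarith

open scoped Classical in
theorem gap_le_height {σ : Finset ι} {w : Realization K} {i : ι} (hi : i ∈ σ) :
    gap σ w ≤ w.height i := by
  have h1 : (1 - w.height i : ℝ≥0) ≤ σ.sup fun i => 1 - w.height i :=
    Finset.le_sup (f := fun i => 1 - w.height i) hi
  rw [← NNReal.coe_le_coe, NNReal.coe_sub (w.height_le_one i), NNReal.coe_one] at h1
  have h2 := ((w.weight.support.filter fun j => j ∉ σ).sup w.height).coe_nonneg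
  rw [gap]
  linarith

theorem subset_support_of_gap_pos {σ : Finset ι} {w : Realization K} (h : 0 < gap σ w) :
    σ ⊆ w.weight.support := fun _ hi =>
  height_pos_iff.1 (NNReal.coe_pos.1 (h.trans_le (gap_le_height hi)))

open scoped Classical in
theorem top_subset_of_gap_pos {σ : Finset ι} {w : Realization K} (h : 0 < gap σ w) :
    w.top ⊆ σ := by
  intro j hj
  by_contra hjσ
  have h2 : w.height j ≤ (w.weight.support.filter fun j => j ∉ σ).sup w.height :=
    Finset.le_sup (Finset.mem_filter.2 ⟨w.top_subset hj, hjσ⟩)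
  rw [mem_top.1 hj, ← NNReal.coe_le_coe, NNReal.coe_one] at h2
  have h1 := (σ.sup fun i => 1 - w.height i).coe_nonneg
  rw [gap] at h
  linarith

/-- The sets of positive gap form a chain. -/
theorem subset_of_gap_pos {σ τ : Finset ι} {w : Realization K} (hσ : 0 < gap σ w)
    (hτ : 0 < gap τ w) (h : σ.card ≤ τ.card) : σ ⊆ τ := by
  by_contra hne
  obtain ⟨i, hi, hiτ⟩ := Finset.not_subset.1 hne
  have h' : τ ⊆ σ := by
    intro j hj
    by_contra hjσ
    have h1 := height_add_gap_le (w := w) hi hjσ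
    have h2 := height_add_gap_le (w := w) hj hiτ
    linarith
  exact hne (Finset.eq_of_subset_of_card_le h' h).symm.subset

/-- The gap, rescaled according to the cardinality of the set so that it is at least `1` for some
set of the chain. -/
def level (σ : Finset ι) (w : Realization K) : ℝ := 2 ^ (σ.card + 1) * gap σ w

theorem level_pos_iff {σ : Finset ι} {w : Realization K} : 0 < level σ w ↔ 0 < gap σ w :=
  mul_pos_iff_of_pos_left (by positivity)

open scoped Classical in
/-- If all gaps were small, each superlevel set `{i | 2⁻ⁿ⁻¹ < height i}` would have more than `n`
elements, contradicting the finiteness of the support. -/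
theorem exists_one_le_level (w : Realization K) : ∃ σ, 1 ≤ level σ w := by
  by_contra! h
  let S : ℕ → Finset ι := fun n =>
    w.weight.support.filter fun i => (1 / 2 : ℝ) ^ (n + 1) < w.height i
  have hS : ∀ n, n < (S n).card := by
    intro n
    induction n with
    | zero =>
      obtain ⟨i, hi⟩ := w.top_nonempty
      refine Finset.card_pos.2 ⟨i, Finset.mem_filter.2 ⟨w.top_subset hi, ?_⟩⟩
      rw [mem_top.1 hi]
      norm_num
    | succ n ih =>
      have hmono : S n ⊆ S (n + 1) := fun i hi => by
        obtain ⟨h1, h2⟩ := Finset.mem_filter.1 hi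
        refine Finset.mem_filter.2 ⟨h1, lt_of_le_of_lt ?_ h2⟩
        exact pow_le_pow_of_le_one (by norm_num) (by norm_num) (Nat.le_succ _)
      rcases (Nat.succ_le_of_lt ih).lt_or_eq with hlt | heq
      · exact hlt.trans_le (Finset.card_le_card hmono)
      -- `S n` has `n + 1` elements and a small gap, so a further vertex lies just below it.
      have hlev := h (S n)
      rw [level, ← heq] at hlev
      have hgap : gap (S n) w < (1 / 2) ^ (n + 2) := by
        rw [one_div, inv_pow, ← one_div, lt_div_iff₀' (by positivity)]
        exact hlev
      have hsup : ((S n).sup fun i => 1 - w.height i : ℝ≥0) ≤ 1 - (1 / 2 : ℝ≥0) ^ (n + 1) := by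
        refine Finset.sup_le fun i hi => tsub_le_tsub_left ?_ _
        rw [← NNReal.coe_le_coe]
        push_cast
        exact (Finset.mem_filter.1 hi).2.le
      rw [← NNReal.coe_le_coe, NNReal.coe_sub (pow_le_one₀ (by positivity) (by
        rw [← NNReal.coe_le_coe]; norm_num))] at hsup
      push_cast at hsup
      have hlt : (1 / 2 : ℝ≥0) ^ (n + 2) <
          (w.weight.support.filter fun j => j ∉ S n).sup w.height := by
        rw [← NNReal.coe_lt_coe]
        rw [gap] at hgap
        push_cast
        rw [pow_succ _ (n + 1)] at hgap ⊢
        linarith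
      obtain ⟨j, hj, hlt⟩ := Finset.lt_sup_iff.1 hlt
      obtain ⟨hj1, hj2⟩ := Finset.mem_filter.1 hj
      rw [← NNReal.coe_lt_coe] at hlt
      push_cast at hlt
      have hss : S n ⊂ S (n + 1) :=
        Finset.ssubset_iff_subset_ne.2 ⟨hmono, fun he =>
          hj2 (he ▸ Finset.mem_filter.2 ⟨hj1, hlt⟩)⟩
      exact (Nat.succ_le_of_lt ih).trans_lt (Finset.card_lt_card hss)
  exact absurd (Finset.card_filter_le w.weight.support _) (hS w.weight.support.card).not_ge

/-! ### Continuity of the gaps -/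

section Continuity

variable {Y : Type*} [TopologicalSpace Y] {f : Y → Realization K} {F : Finset ι} {y₀ : Y}

theorem continuousAt_threshold (hf : ∀ i, Continuous fun y => (f y).weight i)
    (hF : ∀ᶠ y in 𝓝 y₀, (f y).weight.support ⊆ F) :
    ContinuousAt (fun y => (f y).threshold) y₀ := by
  have : ContinuousAt (fun y => (∑ i ∈ F, (f y).weight i ^ 2) / 2) y₀ :=
    ((continuous_finsetSum _ fun i _ => (hf i).pow 2).div_const 2).continuousAt
  exact this.congr (hF.mono fun y hy => ((f y).threshold_eq_of_subset hy).symm)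

theorem continuousAt_height (hf : ∀ i, Continuous fun y => (f y).weight i)
    (hF : ∀ᶠ y in 𝓝 y₀, (f y).weight.support ⊆ F) (i : ι) :
    ContinuousAt (fun y => (f y).height i) y₀ := by
  refine ContinuousAt.inf (continuous_real_toNNReal.continuousAt.comp ?_) continuousAt_const
  exact (hf i).continuousAt.div (continuousAt_threshold hf hF) (f y₀).threshold_pos.ne'

open scoped Classical in
theorem continuousAt_gap (hf : ∀ i, Continuous fun y => (f y).weight i)
    (hF : ∀ᶠ y in 𝓝 y₀, (f y).weight.support ⊆ F) (σ : Finset ι) :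
    ContinuousAt (fun y => gap σ (f y)) y₀ := by
  have hsup : ∀ y, (f y).weight.support ⊆ F →
      ((f y).weight.support.filter fun j => j ∉ σ).sup (f y).height =
        (F.filter fun j => j ∉ σ).sup fun j => (f y).height j := by
    intro y hy
    refine le_antisymm (Finset.sup_mono (Finset.filter_subset_filter _ hy)) (Finset.sup_le ?_)
    intro j hj
    by_cases hjw : j ∈ (f y).weight.support
    · exact Finset.le_sup (Finset.mem_filter.2 ⟨hjw, (Finset.mem_filter.1 hj).2⟩)
    · rw [← height_pos_iff, not_lt, nonpos_iff_eq_zero] at hjw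
      rw [hjw]
      exact zero_le
  have h1 : ContinuousAt (fun y => σ.sup fun i => 1 - (f y).height i) y₀ :=
    ContinuousAt.finset_sup_apply fun i _ =>
      continuousAt_const.sub (continuousAt_height hf hF i)
  have h2 : ContinuousAt (fun y => (F.filter fun j => j ∉ σ).sup fun j => (f y).height j) y₀ :=
    ContinuousAt.finset_sup_apply fun i _ => continuousAt_height hf hF i
  have h3 : ContinuousAt (fun y => ((f y).weight.support.filter fun j => j ∉ σ).sup
      (f y).height) y₀ := h2.congr (hF.mono fun y hy => (hsup y hy).symm)
  exact (continuousAt_const.sub (NNReal.continuous_coe.continuousAt.comp h1)).sub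
    (NNReal.continuous_coe.continuousAt.comp h3)

theorem continuousAt_level (hf : ∀ i, Continuous fun y => (f y).weight i)
    (hF : ∀ᶠ y in 𝓝 y₀, (f y).weight.support ⊆ F) (σ : Finset ι) :
    ContinuousAt (fun y => level σ (f y)) y₀ :=
  continuousAt_const.mul (continuousAt_gap hf hF σ)

end Continuity

end Realization

/-! ### Equivariant contractions -/

namespace InvariantOpenCover

variable {G X ι : Type*} [Group G] [TopologicalSpace X] [MulAction G X] [MulAction G ι]
  (𝒰 : InvariantOpenCover G X ι)

theorem mem_inter {σ : Finset ι} {x : X} : x ∈ 𝒰.inter σ ↔ ∀ i ∈ σ, x ∈ 𝒰.U i :=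
  Set.mem_iInter₂

theorem inter_anti {σ τ : Finset ι} (h : σ ⊆ τ) : 𝒰.inter τ ⊆ 𝒰.inter σ :=
  Set.biInter_subset_biInter_left h

theorem isOpen_inter (σ : Finset ι) : IsOpen (𝒰.inter σ) :=
  isOpen_biInter_finset fun i _ => 𝒰.isOpen i

theorem smul_mem_inter_smulSimplex {σ : Finset ι} (g : G) {x : X} (hx : x ∈ 𝒰.inter σ) :
    g • x ∈ 𝒰.inter (smulSimplex g σ) := by
  refine 𝒰.mem_inter.2 fun i hi => ?_
  have h := 𝒰.smul_mem_U (g := g) (𝒰.mem_inter.1 hx _ (mem_smulSimplex.1 hi))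
  rwa [smul_inv_smul] at h

theorem smulSimplex_one (σ : Finset ι) : smulSimplex (1 : G) σ = σ := by
  ext i
  rw [mem_smulSimplex, inv_one, one_smul]

theorem smulSimplex_mul (g h : G) (σ : Finset ι) :
    smulSimplex (g * h) σ = smulSimplex g (smulSimplex h σ) := by
  ext i
  rw [mem_smulSimplex, mem_smulSimplex, mem_smulSimplex, mul_inv_rev, mul_smul]

theorem card_smulSimplex (g : G) (σ : Finset ι) : (smulSimplex g σ).card = σ.card :=
  Finset.card_map _

theorem mem_isotropy_of_smulSimplex_eq {σ : Finset ι} {g : G} (h : smulSimplex g σ = σ) :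
    g ∈ isotropy G σ := by
  refine MulAction.mem_stabilizer_iff.2 (Set.ext fun i => ?_)
  rw [Set.mem_smul_set_iff_inv_smul_mem, Finset.mem_coe, Finset.mem_coe, ← mem_smulSimplex, h]

variable {𝒰} in
/-- A contraction of `U_σ`, encoded as a function of all points of `X` and all real times. It is the
identity of `X` at nonpositive times and constant on `U_σ` at each time `t ≥ 1`; no other condition
is imposed outside `U_σ`. -/
structure IsContraction (σ : Finset ι) (k : X → ℝ → X) : Prop where
  mem : ∀ {x}, x ∈ 𝒰.inter σ → ∀ t, k x t ∈ 𝒰.inter σ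
  continuousAt : ∀ {x}, x ∈ 𝒰.inter σ → ∀ t, ContinuousAt (fun q : X × ℝ => k q.1 q.2) (x, t)
  of_nonpos : ∀ x {t}, t ≤ 0 → k x t = x
  of_one_le : ∀ {x y}, x ∈ 𝒰.inter σ → y ∈ 𝒰.inter σ → ∀ {t}, 1 ≤ t → k x t = k y t

open scoped Classical in
theorem exists_isContraction_of_gContractible [ContinuousConstSMul G X] {σ : Finset ι}
    (h : GContractible (isotropy G σ) (𝒰.inter σ)) :
    ∃ k, IsContraction (𝒰 := 𝒰) σ k ∧ ∀ g ∈ isotropy G σ, ∀ x t, k (g • x) t = g • k x t := by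
  obtain ⟨φ, ψ, -, -, ⟨H, H0, H1, Hg⟩, -⟩ := h
  let p : ℝ → unitInterval := fun t => Set.projIcc 0 1 zero_le_one (1 - t)
  have hp : Continuous p := continuous_projIcc.comp (continuous_const.sub continuous_id)
  have hp0 : ∀ t, t ≤ 0 → p t = 1 := fun t ht => Set.projIcc_of_right_le _ (by linarith)
  have hp1 : ∀ t, 1 ≤ t → p t = 0 := fun t ht => Set.projIcc_of_le_left _ (by linarith)
  let k : X → ℝ → X := fun x t => if hx : x ∈ 𝒰.inter σ then H (⟨x, hx⟩, p t) else x
  have hk : ∀ {x} (hx : x ∈ 𝒰.inter σ) t, k x t = H (⟨x, hx⟩, p t) := fun hx t => dif_pos hx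
  refine ⟨k, ⟨fun hx t => ?_, fun {x} hx t => ?_, fun x t ht => ?_, fun {x y} hx hy {t} ht => ?_⟩,
    fun g hg x t => ?_⟩
  · rw [hk hx]
    exact Subtype.coe_prop _
  · have hopen : IsOpen (𝒰.inter σ ×ˢ (Set.univ : Set ℝ)) := (𝒰.isOpen_inter σ).prod isOpen_univ
    refine ContinuousOn.continuousAt ?_ (hopen.mem_nhds ⟨hx, trivial⟩)
    rw [continuousOn_iff_continuous_domRestrict]
    have : (𝒰.inter σ ×ˢ (Set.univ : Set ℝ)).domRestrict (fun q : X × ℝ => k q.1 q.2) =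
        fun q => (H (⟨q.1.1, q.2.1⟩, p q.1.2) : X) := funext fun q => hk q.2.1 _
    rw [this]
    exact continuous_subtype_val.comp (H.continuous.comp
      (((continuous_fst.comp continuous_subtype_val).subtype_mk _).prodMk
        (hp.comp (continuous_snd.comp continuous_subtype_val))))
  · by_cases hx : x ∈ 𝒰.inter σ
    · rw [hk hx, hp0 t ht, H1]
      rfl
    · exact dif_neg hx
  · rw [hk hx, hk hy, hp1 t ht, H0, H0]
    rfl
  · by_cases hx : x ∈ 𝒰.inter σ
    · have h1 := 𝒰.smul_mem_inter ⟨g, hg⟩ hx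
      rw [hk hx, hk h1]
      exact congrArg Subtype.val (Hg (p t) ⟨g, hg⟩ ⟨x, hx⟩)
    · have h1 : g • x ∉ 𝒰.inter σ := fun h1 => hx (by
        have h2 := 𝒰.smul_mem_inter ⟨g⁻¹, inv_mem hg⟩ h1
        rwa [Subgroup.coe_mk, inv_smul_smul] at h2)
      exact (dif_neg h1).trans (congrArg (g • ·) (show k x t = x from dif_neg hx).symm)

/-- A choice of contractions of all the sets `U_σ` which is compatible with the action of `G`. -/
structure ContractionSystem where
  map : Finset ι → X → ℝ → X
  isContraction : ∀ {σ}, σ ∈ 𝒰.nerve.faces → IsContraction (𝒰 := 𝒰) σ (map σ)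
  map_smul : ∀ {σ}, σ ∈ 𝒰.nerve.faces → ∀ (g : G) (x : X) (t : ℝ),
    map (smulSimplex g σ) (g • x) t = g • map σ x t

theorem mem_nerve_of_smulSimplex {g : G} {σ : Finset ι} (h : smulSimplex g σ ∈ 𝒰.nerve.faces) :
    σ ∈ 𝒰.nerve.faces := by
  have := 𝒰.smulSimplex_mem_nerve g⁻¹ h
  rwa [← smulSimplex_mul, inv_mul_cancel, smulSimplex_one] at this

theorem IsContraction.conj [ContinuousConstSMul G X] {σ : Finset ι} {k : X → ℝ → X}
    (hk : IsContraction (𝒰 := 𝒰) σ k) (g : G) :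
    IsContraction (𝒰 := 𝒰) (smulSimplex g σ) fun x t => g • k (g⁻¹ • x) t := by
  have hmem : ∀ {x}, x ∈ 𝒰.inter (smulSimplex g σ) → g⁻¹ • x ∈ 𝒰.inter σ := fun hx => by
    have := 𝒰.smul_mem_inter_smulSimplex g⁻¹ hx
    rwa [← smulSimplex_mul, inv_mul_cancel, smulSimplex_one] at this
  refine ⟨fun hx t => 𝒰.smul_mem_inter_smulSimplex g (hk.mem (hmem hx) t), fun {x} hx t => ?_,
    fun x t ht => ?_, fun {x y} hx hy {t} ht => ?_⟩
  · have h1 : ContinuousAt (fun q : X × ℝ => (g⁻¹ • q.1, q.2)) (x, t) :=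
      ((continuous_fst.const_smul g⁻¹).prodMk continuous_snd).continuousAt
    have h2 := hk.continuousAt (hmem hx) t
    exact (ContinuousAt.comp (f := fun q : X × ℝ => (g⁻¹ • q.1, q.2))
      (g := fun q : X × ℝ => k q.1 q.2) h2 h1).const_smul g
  · simp only [hk.of_nonpos _ ht, smul_inv_smul]
  · simp only [hk.of_one_le (hmem hx) (hmem hy) ht]

/-- Contractions are chosen on one simplex of each `G`-orbit and transported along the orbit, which
is unambiguous because they are equivariant under the isotropy groups. -/
theorem exists_contractionSystem [ContinuousConstSMul G X]
    (h : ∀ σ ∈ 𝒰.nerve.faces, GContractible (isotropy G σ) (𝒰.inter σ)) :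
    Nonempty 𝒰.ContractionSystem := by
  have h' : ∀ σ : Finset ι, ∃ k : X → ℝ → X, σ ∈ 𝒰.nerve.faces →
      IsContraction (𝒰 := 𝒰) σ k ∧ ∀ g ∈ isotropy G σ, ∀ x t, k (g • x) t = g • k x t := by
    intro σ
    by_cases hσ : σ ∈ 𝒰.nerve.faces
    · obtain ⟨k, hk⟩ := 𝒰.exists_isContraction_of_gContractible (h σ hσ)
      exact ⟨k, fun _ => hk⟩
    · exact ⟨fun x _ => x, fun h => absurd h hσ⟩
  choose k hk using h'
  let s : Setoid (Finset ι) :=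
    { r := fun σ τ => ∃ g : G, smulSimplex g σ = τ
      iseqv := ⟨fun σ => ⟨1, smulSimplex_one σ⟩,
        fun {σ τ} ⟨g, hg⟩ => ⟨g⁻¹, by
          rw [← hg, ← smulSimplex_mul, inv_mul_cancel, smulSimplex_one]⟩,
        fun {σ τ υ} ⟨g, hg⟩ ⟨g', hg'⟩ => ⟨g' * g, by rw [smulSimplex_mul, hg, hg']⟩⟩ }
  let r : Finset ι → Finset ι := fun σ => (Quotient.mk s σ).out
  have hr : ∀ σ, ∃ g : G, smulSimplex g (r σ) = σ := fun σ =>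
    Quotient.exact (Quotient.out_eq (Quotient.mk s σ))
  choose γ hγ using hr
  have hrmem : ∀ {σ}, σ ∈ 𝒰.nerve.faces → r σ ∈ 𝒰.nerve.faces := fun {σ} hσ =>
    𝒰.mem_nerve_of_smulSimplex (g := γ σ) (by rwa [hγ])
  refine ⟨⟨fun σ x t => γ σ • k (r σ) ((γ σ)⁻¹ • x) t, fun {σ} hσ => ?_, fun {σ} hσ g x t => ?_⟩⟩
  · have := (hk (r σ) (hrmem hσ)).1.conj 𝒰 (γ σ)
    rwa [hγ] at this
  · have hrg : r (smulSimplex g σ) = r σ :=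
      congrArg Quotient.out (Quotient.sound (s := s) ⟨g, rfl⟩).symm
    -- The two ways to reach `g σ` from the representative differ by an element of its isotropy.
    have hiso : (γ (smulSimplex g σ))⁻¹ * g * γ σ ∈ isotropy G (r σ) := by
      refine mem_isotropy_of_smulSimplex_eq ?_
      have e := hγ (smulSimplex g σ)
      rw [hrg] at e
      have e' := smulSimplex_one (G := G) (r σ)
      rw [← inv_mul_cancel (γ (smulSimplex g σ)), smulSimplex_mul, e] at e'
      rw [smulSimplex_mul, smulSimplex_mul, hγ, e']
    have h1 := (hk (r σ) (hrmem hσ)).2 _ hiso ((γ σ)⁻¹ • x) t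
    simp only [hrg]
    rw [mul_smul, mul_smul, smul_inv_smul] at h1
    rw [h1, mul_smul, mul_smul, smul_inv_smul]

/-! ### Composing the contractions along a chain of simplices -/

namespace ContractionSystem

open Realization

variable {𝒰} (k : 𝒰.ContractionSystem)

open scoped Classical in
/-- The contraction of `U_σ` at time `u * level σ w`, if there is a set `σ` with `n` elements and
positive gap (there is at most one such `σ`), and the identity otherwise. -/
def stage (w : Realization 𝒰.nerve) (u : ℝ) (n : ℕ) (x : X) : X :=
  if h : ∃ σ : Finset ι, σ.card = n ∧ 0 < gap σ w then k.map h.choose x (u * level h.choose w)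
  else x

/-- The composite of the contractions along the chain of the sets of positive gap with at most `n`
elements, the contractions belonging to larger sets being applied first. -/
def flow (w : Realization 𝒰.nerve) (u : ℝ) : ℕ → X → X
  | 0, x => x
  | n + 1, x => flow w u n (k.stage w u (n + 1) x)

/-- The condition under which `flow w u n` may be applied to `x`: the point `x` lies in `U_σ` for
every `σ ⊆ F` contained in all the members of the chain of `w` which have more than `n` elements.
-/
def Admissible (w : Realization 𝒰.nerve) (F : Finset ι) (n : ℕ) (x : X) : Prop :=
  ∀ σ ⊆ F, (∀ ρ : Finset ι, n < ρ.card → 0 < gap ρ w → σ ⊆ ρ) → x ∈ 𝒰.inter σ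

variable {w : Realization 𝒰.nerve} {u : ℝ} {n : ℕ} {x y : X} {σ F : Finset ι}

theorem stage_of_gap_pos (hσ : 0 < gap σ w) :
    k.stage w u σ.card x = k.map σ x (u * level σ w) := by
  have h : ∃ τ : Finset ι, τ.card = σ.card ∧ 0 < gap τ w := ⟨σ, rfl, hσ⟩
  have he : h.choose = σ := Finset.eq_of_subset_of_card_le
    (subset_of_gap_pos h.choose_spec.2 hσ h.choose_spec.1.le) h.choose_spec.1.ge
  rw [stage, dif_pos h, he]

theorem stage_of_not (h : ¬ ∃ σ : Finset ι, σ.card = n ∧ 0 < gap σ w) :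
    k.stage w u n x = x := dif_neg h

theorem mem_faces_of_gap_pos (hσ : 0 < gap σ w) : σ ∈ 𝒰.nerve.faces :=
  (𝒰.nerve.isRelLowerSet_faces w.support_mem).2 (subset_support_of_gap_pos hσ)
    (w.top_nonempty.mono (top_subset_of_gap_pos hσ))

theorem Admissible.mem_of_gap_pos (h : Admissible w F n x) (hF : w.weight.support ⊆ F)
    (hσ : 0 < gap σ w) (hn : σ.card ≤ n) : x ∈ 𝒰.inter σ :=
  h σ ((subset_support_of_gap_pos hσ).trans hF) fun _ hρn hρ =>
    subset_of_gap_pos hσ hρ (hn.trans hρn.le)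

theorem admissible_of_mem_inter (hx : x ∈ 𝒰.inter F) : Admissible w F n x :=
  fun _ hσ _ => 𝒰.inter_anti hσ hx

theorem Admissible.stage (h : Admissible w F (n + 1) x) (hF : w.weight.support ⊆ F) :
    Admissible w F n (k.stage w u (n + 1) x) := by
  intro τ hτ hρ
  by_cases hex : ∃ σ : Finset ι, σ.card = n + 1 ∧ 0 < gap σ w
  · obtain ⟨σ, hσn, hσ⟩ := hex
    rw [← hσn, k.stage_of_gap_pos hσ]
    exact 𝒰.inter_anti (hρ σ (by omega) hσ)
      ((k.isContraction (mem_faces_of_gap_pos hσ)).mem (h.mem_of_gap_pos hF hσ hσn.le) _)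
  · rw [k.stage_of_not hex]
    refine h τ hτ fun ρ hn hρ' => hρ ρ (by omega) hρ'

theorem Admissible.flow (h : Admissible w F n x) (hF : w.weight.support ⊆ F) :
    Admissible w F 0 (k.flow w u n x) := by
  induction n generalizing x with
  | zero => exact h
  | succ n ih => exact ih (h.stage k hF)

theorem flow_mem_inter_top (h : Admissible w F n x) (hF : w.weight.support ⊆ F) :
    k.flow w u n x ∈ 𝒰.inter w.top :=
  h.flow k hF _ (w.top_subset.trans hF) fun _ _ => top_subset_of_gap_pos

theorem flow_zero_right : k.flow w 0 n x = x := by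
  induction n generalizing x with
  | zero => rfl
  | succ n ih =>
    rw [flow, ih]
    by_cases hex : ∃ σ : Finset ι, σ.card = n + 1 ∧ 0 < gap σ w
    · obtain ⟨σ, hσn, hσ⟩ := hex
      rw [← hσn, k.stage_of_gap_pos hσ, zero_mul]
      exact (k.isContraction (mem_faces_of_gap_pos hσ)).of_nonpos _ le_rfl
    · exact k.stage_of_not hex

theorem flow_eq_of_card_le (h : w.weight.support.card ≤ n) :
    k.flow w u n x = k.flow w u w.weight.support.card x := by
  induction n, h using Nat.le_induction with
  | base => rfl
  | succ n hn ih =>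
    rw [flow, k.stage_of_not, ih]
    rintro ⟨σ, hσn, hσ⟩
    have := Finset.card_le_card (subset_support_of_gap_pos hσ)
    omega

/-- At `u = 1` the flow does not depend on the starting point, since one of the contractions of the
chain has then been carried out completely. -/
theorem flow_one_eq (hF : w.weight.support ⊆ F) (hn : w.weight.support.card ≤ n)
    (hx : Admissible w F n x) (hy : Admissible w F n y) : k.flow w 1 n x = k.flow w 1 n y := by
  obtain ⟨τ, hτ⟩ := w.exists_one_le_level
  have hτ0 : 0 < gap τ w := level_pos_iff.1 (one_pos.trans_le hτ)
  replace hn : τ.card ≤ n := (Finset.card_le_card (subset_support_of_gap_pos hτ0)).trans hn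
  have hτpos : 0 < τ.card :=
    Finset.card_pos.2 (w.top_nonempty.mono (top_subset_of_gap_pos hτ0))
  induction n generalizing x y with
  | zero => omega
  | succ n ih =>
    rw [flow, flow]
    rcases hn.lt_or_eq with hlt | heq
    · exact ih (hx.stage k hF) (hy.stage k hF) (by omega)
    · congr 1
      rw [← heq, k.stage_of_gap_pos hτ0, k.stage_of_gap_pos hτ0]
      exact (k.isContraction (mem_faces_of_gap_pos hτ0)).of_one_le
        (hx.mem_of_gap_pos hF hτ0 heq.le) (hy.mem_of_gap_pos hF hτ0 heq.le) (by rwa [one_mul])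

/-! ### Equivariance of the flow -/

theorem support_smul (g : G) (w : Realization 𝒰.nerve) :
    (g • w).weight.support = smulSimplex g w.weight.support := by
  ext i
  rw [mem_smulSimplex, Finsupp.mem_support_iff, Finsupp.mem_support_iff, 𝒰.weight_smul]

theorem threshold_smul (g : G) (w : Realization 𝒰.nerve) : (g • w).threshold = w.threshold := by
  rw [(g • w).threshold_eq_of_subset subset_rfl, support_smul, smulSimplex, Finset.sum_map,
    w.threshold_eq_of_subset subset_rfl]
  congr 1
  refine Finset.sum_congr rfl fun i _ => ?_
  rw [𝒰.weight_smul]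
  exact congrArg (fun j => w.weight j ^ 2) (inv_smul_smul g i)

theorem height_smul (g : G) (w : Realization 𝒰.nerve) (i : ι) :
    (g • w).height i = w.height (g⁻¹ • i) := by
  rw [height, height, threshold_smul, 𝒰.weight_smul]

theorem gap_smul (g : G) (σ : Finset ι) (w : Realization 𝒰.nerve) :
    gap (smulSimplex g σ) (g • w) = gap σ w := by
  classical
  have h1 : ((smulSimplex g σ).sup fun i => 1 - (g • w).height i) =
      σ.sup fun i => 1 - w.height i := by
    rw [smulSimplex, Finset.sup_map]
    refine Finset.sup_congr rfl fun i _ => ?_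
    rw [Function.comp, height_smul]
    exact congrArg (fun j => 1 - w.height j) (inv_smul_smul g i)
  have h2 : ((g • w).weight.support.filter fun j => j ∉ smulSimplex g σ) =
      smulSimplex g (w.weight.support.filter fun j => j ∉ σ) := by
    ext i
    simp only [support_smul, Finset.mem_filter, mem_smulSimplex]
  have h3 : ((g • w).weight.support.filter fun j => j ∉ smulSimplex g σ).sup (g • w).height =
      (w.weight.support.filter fun j => j ∉ σ).sup w.height := by
    rw [h2, smulSimplex, Finset.sup_map]
    refine Finset.sup_congr rfl fun i _ => ?_
    rw [Function.comp, height_smul]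
    exact congrArg w.height (inv_smul_smul g i)
  rw [gap, gap, h1]
  congr 2

theorem level_smul (g : G) (σ : Finset ι) (w : Realization 𝒰.nerve) :
    level (smulSimplex g σ) (g • w) = level σ w := by
  rw [level, level, gap_smul, card_smulSimplex]

theorem stage_smul (g : G) : k.stage (g • w) u n (g • x) = g • k.stage w u n x := by
  by_cases hex : ∃ σ : Finset ι, σ.card = n ∧ 0 < gap σ w
  · obtain ⟨σ, hσn, hσ⟩ := hex
    have h1 := k.stage_of_gap_pos (u := u) (x := g • x) (w := g • w) (σ := smulSimplex g σ)
      (by rwa [gap_smul])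
    rw [card_smulSimplex, hσn] at h1
    rw [h1, ← hσn, k.stage_of_gap_pos hσ, level_smul, k.map_smul (mem_faces_of_gap_pos hσ)]
  · rw [k.stage_of_not hex, k.stage_of_not]
    rintro ⟨σ, hσn, hσ⟩
    refine hex ⟨smulSimplex g⁻¹ σ, (card_smulSimplex _ _).trans hσn, ?_⟩
    have := gap_smul g⁻¹ σ (g • w)
    rw [inv_smul_smul] at this
    rwa [this]

theorem flow_smul (g : G) : k.flow (g • w) u n (g • x) = g • k.flow w u n x := by
  induction n generalizing x with
  | zero => rfl
  | succ n ih => rw [flow, flow, stage_smul, ih]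

/-! ### Continuity of the flow -/

section Continuity

variable {Y : Type*} [TopologicalSpace Y] {f : Y → Realization 𝒰.nerve} {v : Y → ℝ} {b : Y → X}
  {y₀ : Y}

/-- Near `y₀`, a set `σ` with `n + 1` elements that is contained in all the larger members of the
chain at `y₀` contributes a contraction of `U_σ` near a point of `U_σ`; all other `σ` with `n + 1`
elements do not contribute. -/
theorem continuousAt_stage (hf : ∀ i, Continuous fun y => (f y).weight i)
    (hF : ∀ᶠ y in 𝓝 y₀, (f y).weight.support ⊆ F) (hv : ContinuousAt v y₀) (hv0 : 0 ≤ v y₀)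
    (hb : ContinuousAt b y₀) (h : Admissible (f y₀) F (n + 1) (b y₀)) :
    ContinuousAt (fun y => k.stage (f y) (v y) (n + 1) (b y)) y₀ := by
  have hmap : ∀ σ ∈ 𝒰.nerve.faces, b y₀ ∈ 𝒰.inter σ →
      ContinuousAt (fun y => k.map σ (b y) (v y * level σ (f y))) y₀ := fun σ hσ hbσ =>
    ContinuousAt.comp (f := fun y => (b y, v y * level σ (f y)))
      ((k.isContraction hσ).continuousAt hbσ _) (hb.prodMk (hv.mul (continuousAt_level hf hF σ)))
  have hgap : ∀ σ : Finset ι, 0 < gap σ (f y₀) → ∀ᶠ y in 𝓝 y₀, 0 < gap σ (f y) := fun σ hσ =>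
    (continuousAt_gap hf hF σ).eventually (lt_mem_nhds hσ)
  by_cases hex : ∃ σ : Finset ι, σ.card = n + 1 ∧ 0 < gap σ (f y₀)
  · obtain ⟨σ, hσn, hσ⟩ := hex
    refine (hmap σ (mem_faces_of_gap_pos hσ)
      (h.mem_of_gap_pos hF.self_of_nhds hσ hσn.le)).congr ((hgap σ hσ).mono fun y hy => ?_)
    change _ = k.stage (f y) (v y) (n + 1) (b y)
    rw [← hσn, k.stage_of_gap_pos hy]
  · rw [ContinuousAt, k.stage_of_not hex]
    intro V hV
    have hall : ∀ᶠ y in 𝓝 y₀, ∀ σ ∈ F.powersetCard (n + 1), 0 < gap σ (f y) →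
        k.map σ (b y) (v y * level σ (f y)) ∈ V := by
      refine (Filter.eventually_all_finset _).2 fun σ hσ => ?_
      obtain ⟨hσF, hσn⟩ := Finset.mem_powersetCard.1 hσ
      by_cases hcomp : ∀ ρ : Finset ι, n + 1 < ρ.card → 0 < gap ρ (f y₀) → σ ⊆ ρ
      · have hbσ := h σ hσF hcomp
        have hσK : σ ∈ 𝒰.nerve.faces := ⟨Finset.card_pos.1 (by omega), _, hbσ⟩
        -- Near `y₀` the contraction of `U_σ` is run for a time close to `0` or negative.
        have hle : v y₀ * level σ (f y₀) ≤ 0 := mul_nonpos_of_nonneg_of_nonpos hv0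
          (not_lt.1 fun h0 => hex ⟨σ, hσn, level_pos_iff.1 h0⟩)
        have hc := hmap σ hσK hbσ
        rw [ContinuousAt, (k.isContraction hσK).of_nonpos _ hle] at hc
        exact (hc.eventually_mem hV).mono fun y hy _ => hy
      · push Not at hcomp
        obtain ⟨ρ, hρn, hρ, hσρ⟩ := hcomp
        -- `ρ` stays in the chain near `y₀`, which keeps `σ` out of it.
        exact (hgap ρ hρ).mono fun y hy hσy =>
          absurd (subset_of_gap_pos hσy hy (by omega)) hσρ
    change ∀ᶠ y in 𝓝 y₀, k.stage (f y) (v y) (n + 1) (b y) ∈ V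
    filter_upwards [hall, hF, hb.eventually_mem hV] with y hy hyF hbV
    by_cases hexy : ∃ σ : Finset ι, σ.card = n + 1 ∧ 0 < gap σ (f y)
    · obtain ⟨σ, hσn, hσ⟩ := hexy
      rw [← hσn, k.stage_of_gap_pos hσ]
      exact hy σ (Finset.mem_powersetCard.2 ⟨(subset_support_of_gap_pos hσ).trans hyF, hσn⟩) hσ
    · rwa [k.stage_of_not hexy]

theorem continuousAt_flow (hf : ∀ i, Continuous fun y => (f y).weight i)
    (hF : ∀ᶠ y in 𝓝 y₀, (f y).weight.support ⊆ F) (hv : ContinuousAt v y₀) (hv0 : 0 ≤ v y₀)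
    (hb : ContinuousAt b y₀) (h : Admissible (f y₀) F n (b y₀)) :
    ContinuousAt (fun y => k.flow (f y) (v y) n (b y)) y₀ := by
  induction n generalizing b with
  | zero => exact hb
  | succ n ih =>
    exact ih (k.continuousAt_stage hf hF hv hv0 hb h) (h.stage k hF.self_of_nhds)

end Continuity

/-- The flow along the whole chain of `w`. -/
def fullFlow (w : Realization 𝒰.nerve) (u : ℝ) (x : X) : X := k.flow w u w.weight.support.card x

theorem fullFlow_one_eq (hF : w.weight.support ⊆ F) (hx : x ∈ 𝒰.inter F)
    (hy : y ∈ 𝒰.inter w.weight.support) : k.fullFlow w 1 x = k.fullFlow w 1 y :=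
  k.flow_one_eq subset_rfl le_rfl
    (admissible_of_mem_inter (𝒰.inter_anti hF hx)) (admissible_of_mem_inter hy)

theorem fullFlow_smul (g : G) : k.fullFlow (g • w) u (g • x) = g • k.fullFlow w u x := by
  rw [fullFlow, support_smul, card_smulSimplex, flow_smul, fullFlow]

theorem continuousAt_fullFlow {Y : Type*} [TopologicalSpace Y] {f : Y → Realization 𝒰.nerve}
    {v : Y → ℝ} {b : Y → X} {y₀ : Y} (hf : ∀ i, Continuous fun y => (f y).weight i)
    (hF : ∀ᶠ y in 𝓝 y₀, (f y).weight.support ⊆ F) (hv : ContinuousAt v y₀) (hv0 : 0 ≤ v y₀)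
    (hb : ContinuousAt b y₀) (h : b y₀ ∈ 𝒰.inter F) :
    ContinuousAt (fun y => k.fullFlow (f y) (v y) (b y)) y₀ := by
  refine (k.continuousAt_flow (n := F.card) hf hF hv hv0 hb (admissible_of_mem_inter h)).congr ?_
  exact hF.mono fun y hy => k.flow_eq_of_card_le (Finset.card_le_card hy)

end ContractionSystem

end InvariantOpenCover

/-! ### Homotopies of maps into the realization -/

section GHomotopy

variable {G X Y : Type*} [Group G] [TopologicalSpace X] [TopologicalSpace Y]
  [MulAction G X] [MulAction G Y] {φ₀ φ₁ φ₂ : C(X, Y)}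

theorem gHomotopic_iff :
    GHomotopic G φ₀ φ₁ ↔ Nonempty (φ₀.HomotopyWith φ₁ fun φ => IsGMap G φ) := by
  constructor
  · rintro ⟨H, h0, h1, hg⟩
    exact ⟨⟨⟨⟨fun q => H (q.2, q.1), by fun_prop⟩, h0, h1⟩, hg⟩⟩
  · rintro ⟨H⟩
    exact ⟨⟨fun q => H (q.2, q.1), by fun_prop⟩, H.apply_zero, H.apply_one, fun t => H.prop t⟩

theorem GHomotopic.trans (h : GHomotopic G φ₀ φ₁) (h' : GHomotopic G φ₁ φ₂) :
    GHomotopic G φ₀ φ₂ :=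
  gHomotopic_iff.2 ((gHomotopic_iff.1 h).map2 (fun H H' => H.trans H') (gHomotopic_iff.1 h'))

end GHomotopy

namespace Realization

variable {ι : Type*} {K : PreAbstractSimplicialComplex ι}

theorem support_mix_subset {F F' : Finset ι} (hF : F ∈ K.faces) {a b : Realization K}
    (ha : a.weight.support ⊆ F) (hb : b.weight.support ⊆ F) (ha' : a.weight.support ⊆ F')
    (hb' : b.weight.support ⊆ F') (t : unitInterval) :
    (mix hF a b ha hb t).weight.support ⊆ F' := by
  classical
  exact Finsupp.support_add.trans (Finset.union_subset
    (Finsupp.support_smul.trans ha') (Finsupp.support_smul.trans hb'))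

/-- The total weight of `w` above the threshold. -/
def excess (w : Realization K) : ℝ := w.weight.sum fun _ a => max (a - w.threshold) 0

theorem excess_eq_of_subset (w : Realization K) {F : Finset ι} (h : w.weight.support ⊆ F) :
    w.excess = ∑ i ∈ F, max (w.weight i - w.threshold) 0 :=
  Finsupp.sum_of_support_subset _ h _ fun _ _ => max_eq_right (by linarith [w.threshold_pos])

theorem excess_pos (w : Realization K) : 0 < w.excess := by
  obtain ⟨i, hi⟩ := w.exists_threshold_lt
  refine Finset.sum_pos' (fun _ _ => le_max_right _ _) ⟨i, ?_, lt_max_of_lt_left (sub_pos.2 hi)⟩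
  exact Finsupp.mem_support_iff.2 (w.threshold_pos.trans hi).ne'

/-- The point of the realization obtained by subtracting the threshold from the coordinates of `w`,
dropping the coordinates that become negative, and normalizing. -/
def concentrate (w : Realization K) : Realization K :=
  have h0 : max (0 - w.threshold) 0 / w.excess = 0 := by
    rw [max_eq_right (by linarith [w.threshold_pos]), zero_div]
  have hsub : (w.weight.mapRange (fun a => max (a - w.threshold) 0 / w.excess) h0).support ⊆
      w.weight.support := Finsupp.support_mapRange
  have hsum : ((w.weight.mapRange (fun a => max (a - w.threshold) 0 / w.excess) h0).sum
      fun _ a => a) = 1 := by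
    rw [Finsupp.sum_of_support_subset _ hsub _ fun _ _ => rfl]
    simp only [Finsupp.mapRange_apply]
    rw [← Finset.sum_div, ← w.excess_eq_of_subset subset_rfl, div_self w.excess_pos.ne']
  { weight := w.weight.mapRange (fun a => max (a - w.threshold) 0 / w.excess) h0
    nonneg := fun _ => div_nonneg (le_max_right _ _) w.excess_pos.le
    sum_eq_one := hsum
    support_mem := support_mem_of_subset hsum w.support_mem hsub }

theorem weight_concentrate (w : Realization K) (i : ι) :
    w.concentrate.weight i = max (w.weight i - w.threshold) 0 / w.excess := rfl

theorem mem_support_concentrate {w : Realization K} {i : ι} :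
    i ∈ w.concentrate.weight.support ↔ w.threshold < w.weight i := by
  rw [Finsupp.mem_support_iff, weight_concentrate, div_ne_zero_iff, and_iff_left w.excess_pos.ne',
    ne_eq, max_eq_right_iff, sub_nonpos, not_le]

theorem support_concentrate_subset (w : Realization K) :
    w.concentrate.weight.support ⊆ w.weight.support := fun _ hi =>
  Finsupp.mem_support_iff.2 (w.threshold_pos.trans (mem_support_concentrate.1 hi)).ne'

theorem continuous_weight_simplexMap (σ : K.faces) (i : ι) :
    Continuous fun p => (simplexMap σ p).weight i :=
  (continuous_weight i).comp (continuous_simplexMap σ)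

theorem continuous_threshold_simplexMap (σ : K.faces) :
    Continuous fun p => (simplexMap σ p).threshold :=
  continuous_iff_continuousAt.2 fun _ => continuousAt_threshold (continuous_weight_simplexMap σ)
    (Filter.Eventually.of_forall (support_simplexMap_subset σ))

theorem continuous_concentrate : Continuous (concentrate (K := K)) := by
  refine continuous_of_simplexMap fun σ => continuous_of_eventually_support_subset (fun i => ?_)
    fun _ => ⟨σ, σ.2, Filter.Eventually.of_forall fun p =>
      (support_concentrate_subset _).trans (support_simplexMap_subset σ p)⟩
  have h : ∀ i, Continuous fun p =>
      max ((simplexMap σ p).weight i - (simplexMap σ p).threshold) 0 := fun i =>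
    ((continuous_weight_simplexMap σ i).sub (continuous_threshold_simplexMap σ)).max
      continuous_const
  refine (h i).div ?_ fun p => (excess_pos _).ne'
  refine (continuous_finsetSum (σ : Finset ι) fun j _ => h j).congr fun p => ?_
  exact (excess_eq_of_subset _ (support_simplexMap_subset σ p)).symm

theorem eventually_support_concentrate_subset_top (σ : K.faces)
    (p₀ : stdSimplex ℝ (σ : Finset ι)) :
    ∀ᶠ p in 𝓝 p₀, (simplexMap σ p).concentrate.weight.support ⊆ (simplexMap σ p₀).top := by
  have h : ∀ᶠ p in 𝓝 p₀, ∀ i ∈ (σ : Finset ι), i ∉ (simplexMap σ p₀).top →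
      (simplexMap σ p).weight i < (simplexMap σ p).threshold := by
    refine (Filter.eventually_all_finset _).2 fun i _ => ?_
    by_cases hi : i ∈ (simplexMap σ p₀).top
    · exact Filter.Eventually.of_forall fun p h => absurd hi h
    · rw [mem_top, height_eq_one_iff, not_le] at hi
      exact ((continuous_weight_simplexMap σ i).continuousAt.eventually_lt
        (continuous_threshold_simplexMap σ).continuousAt hi).mono fun p hp _ => hp
  refine h.mono fun p hp i hi => ?_
  by_contra hne
  exact (hp i (support_simplexMap_subset σ p (support_concentrate_subset _ hi)) hne).not_gt
    (mem_support_concentrate.1 hi)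

end Realization

namespace InvariantOpenCover

open Realization

variable {G X ι : Type*} [Group G] [TopologicalSpace X] [MulAction G X] [MulAction G ι]
  {𝒰 : InvariantOpenCover G X ι}

theorem mem_nerve_of_mem_inter {w : Realization 𝒰.nerve} {F : Finset ι} {x : X}
    (hw : w.weight.support ⊆ F) (hx : x ∈ 𝒰.inter F) : F ∈ 𝒰.nerve.faces :=
  ⟨w.support_nonempty.mono hw, x, hx⟩

/-- Two equivariant self-maps of the realization are homotopic along straight lines if, locally on
each closed simplex, both take values in a common closed simplex. -/
theorem gHomotopic_of_eventually_support_subset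
    {φ₀ φ₁ : C(Realization 𝒰.nerve, Realization 𝒰.nerve)} (h₀ : IsGMap G φ₀) (h₁ : IsGMap G φ₁)
    (h : ∀ (σ : 𝒰.nerve.faces) (p₀ : stdSimplex ℝ (σ : Finset ι)), ∃ F ∈ 𝒰.nerve.faces,
      ∀ᶠ p in 𝓝 p₀, (φ₀ (simplexMap σ p)).weight.support ⊆ F ∧
        (φ₁ (simplexMap σ p)).weight.support ⊆ F) :
    GHomotopic G φ₀ φ₁ := by
  have hpt : ∀ w, ∃ F ∈ 𝒰.nerve.faces, (φ₀ w).weight.support ⊆ F ∧ (φ₁ w).weight.support ⊆ F := by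
    intro w
    obtain ⟨p, hp⟩ := exists_simplexMap_eq ⟨_, w.support_mem⟩ (w := w) subset_rfl
    obtain ⟨F, hF, hev⟩ := h _ p
    rw [← hp]
    exact ⟨F, hF, hev.self_of_nhds⟩
  choose F hF hF₀ hF₁ using hpt
  let H : Realization 𝒰.nerve × unitInterval → Realization 𝒰.nerve := fun q =>
    mix (hF q.1) (φ₀ q.1) (φ₁ q.1) (hF₀ q.1) (hF₁ q.1) q.2
  have hH : ∀ q i, (H q).weight i =
      (1 - (q.2 : ℝ)) * (φ₀ q.1).weight i + (q.2 : ℝ) * (φ₁ q.1).weight i := fun _ _ => rfl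
  have hcont : Continuous H := by
    refine continuous_prod_of_simplexMap fun σ => continuous_of_eventually_support_subset
      (fun i => ?_) fun ⟨p₀, t₀⟩ => ?_
    · simp only [hH]
      have hw : ∀ φ : C(Realization 𝒰.nerve, Realization 𝒰.nerve), Continuous
          fun q : stdSimplex ℝ (σ : Finset ι) × unitInterval =>
            (φ (simplexMap σ q.1)).weight i := fun φ =>
        (continuous_weight i).comp (φ.continuous.comp
          ((continuous_simplexMap σ).comp continuous_fst))
      have ht : Continuous fun q : stdSimplex ℝ (σ : Finset ι) × unitInterval => (q.2 : ℝ) :=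
        continuous_subtype_val.comp continuous_snd
      exact ((continuous_const.sub ht).mul (hw φ₀)).add (ht.mul (hw φ₁))
    · obtain ⟨F', hF', hev⟩ := h σ p₀
      exact ⟨F', hF', ((continuous_fst.tendsto (p₀, t₀)).eventually hev).mono fun q hq =>
        support_mix_subset _ _ _ hq.1 hq.2 _⟩
  refine ⟨⟨H, hcont⟩, fun w => ?_, fun w => ?_, fun t g w => ?_⟩
  · apply Realization.ext
    ext i
    simp [hH]
  · apply Realization.ext
    ext i
    simp [hH]
  · apply Realization.ext
    ext i
    simp only [ContinuousMap.coe_mk, 𝒰.weight_smul, hH, h₀ g w, h₁ g w]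

/-! ### The map to the nerve -/

/-- Averaging a subordinate partition of unity over the finite group `G` gives an equivariant map to
the nerve. -/
theorem exists_equivariant_partitionOfUnity [Finite G] [T2Space X] [ParacompactSpace X]
    [ContinuousConstSMul G X] (𝒰 : InvariantOpenCover G X ι) :
    ∃ f : X → Realization 𝒰.nerve, (∀ i, Continuous fun x => (f x).weight i) ∧
      (∀ x₀, ∃ F, x₀ ∈ 𝒰.inter F ∧ ∀ᶠ x in 𝓝 x₀, (f x).weight.support ⊆ F) ∧
      ∀ (g : G) (x : X), f (g • x) = g • f x := by
  classical
  have := Fintype.ofFinite G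
  obtain ⟨ρ, hρ⟩ := PartitionOfUnity.exists_isSubordinate isClosed_univ 𝒰.U 𝒰.isOpen
    𝒰.iUnion_eq.ge
  let a : X → ι → ℝ := fun x i => (Fintype.card G : ℝ)⁻¹ * ∑ g : G, ρ (g • i) (g • x)
  -- With closed supports, `T x₀` contains the support of the coordinates of all `x` near `x₀`.
  let T : X → Finset ι := fun x =>
    Finset.univ.biUnion fun g : G => smulSimplex g⁻¹ (ρ.fintsupport (g • x))
  have hT : ∀ x, x ∈ 𝒰.inter (T x) := by
    refine fun x => 𝒰.mem_inter.2 fun i hi => ?_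
    obtain ⟨g, -, hg⟩ := Finset.mem_biUnion.1 hi
    rw [mem_smulSimplex, inv_inv, ρ.mem_fintsupport_iff] at hg
    have h := 𝒰.smul_mem_U (g := g⁻¹) (hρ _ hg)
    rwa [inv_smul_smul, inv_smul_smul] at h
  have ha_of : ∀ {x i}, a x i ≠ 0 → ∃ g : G, g • i ∈ ρ.finsupport (g • x) := by
    intro x i h
    obtain ⟨g, -, hg⟩ := Finset.exists_ne_zero_of_sum_ne_zero (right_ne_zero_of_mul h)
    exact ⟨g, (ρ.mem_finsupport _).2 hg⟩
  have hev : ∀ x₀, ∀ᶠ x in 𝓝 x₀, ∀ i, a x i ≠ 0 → i ∈ T x₀ := by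
    intro x₀
    have : ∀ᶠ x in 𝓝 x₀, ∀ g : G, ρ.finsupport (g • x) ⊆ ρ.fintsupport (g • x₀) :=
      Filter.eventually_all.2 fun g =>
        ((continuous_const_smul g).tendsto x₀).eventually (ρ.eventually_finsupport_subset (g • x₀))
    refine this.mono fun x hx i hi => ?_
    obtain ⟨g, hg⟩ := ha_of hi
    refine Finset.mem_biUnion.2 ⟨g, Finset.mem_univ _, ?_⟩
    rw [mem_smulSimplex, inv_inv]
    exact hx g hg
  have hsum : ∀ x, ∑ i ∈ T x, a x i = 1 := by
    intro x
    have h1 : ∀ g : G, ∑ i ∈ T x, ρ (g • i) (g • x) = 1 := by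
      intro g
      have : ∑ i ∈ T x, ρ (g • i) (g • x) = ∑ j ∈ smulSimplex g (T x), ρ j (g • x) := by
        rw [smulSimplex, Finset.sum_map]
        rfl
      rw [this]
      refine ρ.sum_finsupport' (Set.mem_univ _) fun j hj => ?_
      refine mem_smulSimplex.2 (Finset.mem_biUnion.2 ⟨g, Finset.mem_univ _, ?_⟩)
      rw [mem_smulSimplex, inv_inv, smul_inv_smul]
      exact (ρ.eventually_finsupport_subset (g • x)).self_of_nhds hj
    rw [← Finset.mul_sum, Finset.sum_comm, Finset.sum_congr rfl fun g _ => h1 g]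
    simp
  let f : X → Realization 𝒰.nerve := fun x =>
    have hs : (Finsupp.onFinset (T x) (a x) (hev x).self_of_nhds).support ⊆ T x :=
      Finsupp.support_onFinset_subset
    have h1 : ((Finsupp.onFinset (T x) (a x) (hev x).self_of_nhds).sum fun _ b => b) = 1 := by
      rw [Finsupp.sum_of_support_subset _ hs _ fun _ _ => rfl]
      exact hsum x
    { weight := Finsupp.onFinset (T x) (a x) (hev x).self_of_nhds
      nonneg := fun i => mul_nonneg (by positivity)
        (Finset.sum_nonneg fun g _ => ρ.nonneg _ _)
      sum_eq_one := h1
      support_mem := by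
        refine support_mem_of_subset h1 ⟨?_, x, hT x⟩ hs
        rw [Finset.nonempty_iff_ne_empty]
        intro h0
        have := hsum x
        rw [h0, Finset.sum_empty] at this
        exact zero_ne_one this }
  refine ⟨f, fun i => ?_, fun x₀ => ⟨T x₀, hT x₀, (hev x₀).mono fun x hx i hi =>
    hx i (Finsupp.mem_support_iff.1 hi)⟩, fun g x => ?_⟩
  · exact continuous_const.mul (continuous_finsetSum _ fun g _ =>
      (ρ (g • i)).continuous.comp (continuous_const_smul g))
  · apply Realization.ext
    ext i
    change a (g • x) i = a x (g⁻¹ • i)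
    refine congrArg ((Fintype.card G : ℝ)⁻¹ * ·) ?_
    refine Fintype.sum_equiv (Equiv.mulRight g) _ _ fun h => ?_
    rw [Equiv.coe_mulRight, mul_smul, mul_smul, smul_inv_smul]

/-! ### The map from the nerve -/

namespace ContractionSystem

variable (k : 𝒰.ContractionSystem)

/-- The endpoint of the full flow of `w`, started at an arbitrary point of `U_σ`, where `σ` is the
support of `w`. -/
def fromNerve (w : Realization 𝒰.nerve) : X := k.fullFlow w 1 w.support_mem.2.some

theorem fromNerve_eq {w : Realization 𝒰.nerve} {F : Finset ι} {x : X}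
    (hF : w.weight.support ⊆ F) (hx : x ∈ 𝒰.inter F) : k.fromNerve w = k.fullFlow w 1 x :=
  (k.fullFlow_one_eq hF hx w.support_mem.2.some_mem).symm

theorem fromNerve_mem_inter_top (w : Realization 𝒰.nerve) : k.fromNerve w ∈ 𝒰.inter w.top :=
  k.flow_mem_inter_top (admissible_of_mem_inter w.support_mem.2.some_mem) subset_rfl

theorem continuous_fromNerve : Continuous k.fromNerve := by
  refine continuous_of_simplexMap fun σ => ?_
  obtain ⟨x, hx⟩ := σ.2.2
  simp only [fun p => k.fromNerve_eq (support_simplexMap_subset σ p) hx]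
  exact continuous_iff_continuousAt.2 fun p =>
    k.continuousAt_fullFlow (v := fun _ => 1) (b := fun _ => x) (continuous_weight_simplexMap σ)
      (Filter.Eventually.of_forall (support_simplexMap_subset σ)) continuousAt_const zero_le_one
      continuousAt_const hx

theorem fromNerve_smul (g : G) (w : Realization 𝒰.nerve) :
    k.fromNerve (g • w) = g • k.fromNerve w := by
  rw [k.fromNerve_eq (w := g • w) (support_smul g w).subset
    (𝒰.smul_mem_inter_smulSimplex g w.support_mem.2.some_mem), fullFlow_smul, fromNerve]

end ContractionSystem

theorem concentrate_smul (g : G) (w : Realization 𝒰.nerve) :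
    (g • w).concentrate = g • w.concentrate := by
  have hexc : (g • w).excess = w.excess := by
    rw [(g • w).excess_eq_of_subset subset_rfl, ContractionSystem.support_smul, smulSimplex,
      Finset.sum_map, w.excess_eq_of_subset subset_rfl]
    refine Finset.sum_congr rfl fun i _ => ?_
    rw [𝒰.weight_smul, ContractionSystem.threshold_smul]
    exact congrArg (fun j => max (w.weight j - w.threshold) 0) (inv_smul_smul g i)
  apply Realization.ext
  ext i
  rw [𝒰.weight_smul, weight_concentrate, weight_concentrate, hexc,
    ContractionSystem.threshold_smul, 𝒰.weight_smul]

end InvariantOpenCover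

end EquivariantNerve

end

open EquivariantNerve InvariantOpenCover Realization

theorem mainTheorem8 {G X Λ : Type*} [Group G] [Finite G]
    [TopologicalSpace X] [T2Space X] [ParacompactSpace X]
    [MulAction G X] [ContinuousConstSMul G X] [MulAction G Λ]
    (𝒰 : EquivariantNerve.InvariantOpenCover G X Λ)
    (h𝒰 : ∀ σ ∈ 𝒰.nerve.faces,
      EquivariantNerve.GContractible
        (EquivariantNerve.InvariantOpenCover.isotropy G σ) (𝒰.inter σ)) :
    EquivariantNerve.GHomotopyEquivalent G X (EquivariantNerve.Realization 𝒰.nerve) := by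
  obtain ⟨k⟩ := 𝒰.exists_contractionSystem h𝒰
  obtain ⟨f, hf, hfF, hfg⟩ := 𝒰.exists_equivariant_partitionOfUnity
  have hfc : Continuous f := continuous_of_eventually_support_subset hf fun x₀ => by
    obtain ⟨F, hx, hev⟩ := hfF x₀
    exact ⟨F, mem_nerve_of_mem_inter hev.self_of_nhds hx, hev⟩
  let φ : C(X, Realization 𝒰.nerve) := ⟨f, hfc⟩
  let ψ : C(Realization 𝒰.nerve, X) := ⟨k.fromNerve, k.continuous_fromNerve⟩
  let κ : C(Realization 𝒰.nerve, Realization 𝒰.nerve) := ⟨concentrate, continuous_concentrate⟩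
  have hφ : IsGMap G φ := hfg
  have hψ : IsGMap G ψ := k.fromNerve_smul
  have hκ : IsGMap G κ := concentrate_smul
  have hφψ : IsGMap G (φ.comp ψ) := fun g w => (congrArg φ (hψ g w)).trans (hφ g _)
  refine ⟨φ, ψ, hφ, hψ, ?_, ?_⟩
  · refine ⟨⟨fun q => k.fullFlow (f q.1) (1 - (q.2 : ℝ)) q.1, ?_⟩, fun x => ?_, fun x => ?_,
      fun t g x => ?_⟩
    · refine continuous_iff_continuousAt.2 fun ⟨x₀, t₀⟩ => ?_
      obtain ⟨F, hx, hev⟩ := hfF x₀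
      exact k.continuousAt_fullFlow (f := fun q : X × unitInterval => f q.1)
        (fun i => (hf i).comp continuous_fst) ((continuous_fst.tendsto (x₀, t₀)).eventually hev)
        (continuous_const.sub (continuous_subtype_val.comp continuous_snd)).continuousAt
        (sub_nonneg.2 t₀.2.2) continuous_fst.continuousAt hx
    · obtain ⟨F, hx, hev⟩ := hfF x
      change k.fullFlow (f x) (1 - 0) x = k.fromNerve (f x)
      rw [sub_zero, k.fromNerve_eq hev.self_of_nhds hx]
    · change k.fullFlow (f x) (1 - 1) x = x
      rw [sub_self]
      exact k.flow_zero_right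
    · change k.fullFlow (f (g • x)) _ (g • x) = g • k.fullFlow (f x) _ x
      rw [hfg, k.fullFlow_smul]
  -- In general `w` and `φ (ψ w)` lie in no common simplex; `κ w` shares one with each of them.
  · refine GHomotopic.trans (φ₁ := κ)
      (gHomotopic_of_eventually_support_subset hφψ hκ fun σ p₀ => ?_)
      (gHomotopic_of_eventually_support_subset hκ (fun _ _ => rfl) fun σ p₀ => ?_)
    · classical
      obtain ⟨F, hx, hev⟩ := hfF (k.fromNerve (simplexMap σ p₀))
      have htop := k.fromNerve_mem_inter_top (simplexMap σ p₀)
      refine ⟨(simplexMap σ p₀).top ∪ F,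
        ⟨(top_nonempty _).mono Finset.subset_union_left, k.fromNerve (simplexMap σ p₀),
          𝒰.mem_inter.2 fun i hi => (Finset.mem_union.1 hi).elim (𝒰.mem_inter.1 htop i)
            (𝒰.mem_inter.1 hx i)⟩, ?_⟩
      filter_upwards [eventually_support_concentrate_subset_top σ p₀,
        ((k.continuous_fromNerve.comp (continuous_simplexMap σ)).tendsto p₀).eventually hev]
        with p hp hp'
      exact ⟨hp'.trans Finset.subset_union_right, hp.trans Finset.subset_union_left⟩
    · exact ⟨σ, σ.2, Filter.Eventually.of_forall fun p =>
        ⟨(support_concentrate_subset _).trans (support_simplexMap_subset σ p),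
          support_simplexMap_subset σ p⟩⟩
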